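/- Let $\mathbb{T}^2=(\mathbb{R}/2\pi\mathbb{Z})^2$ with coordinates $(x,y)$ and flat metric $g_0=dx^2+dy^2$. A Liouville metric on $\mathbb{T}^2$ is a Riemannian metric of the form $g=Q(x)\,(dx^2+dy^2)$ with $Q>0$ a function on $\mathbb{R}/2\pi\mathbb{Z}$; $\Delta_g$ denotes its Laplace--Beltrami operator, and the eigenvalues $\lambda_1(g)\le\lambda_2(g)\le\cdots$ of $-\Delta_g$ are listed in non-decreasing order, with multiplicities, starting from the label $1$ (so $\lambda_1(g)=0$). Let $n\ge 0$ be an integer and, for $a\in\mathbb{R}$, put $\Phi_a(x,y)=(1+a\cos(nx))\cos y$. (1) For every $k\in\mathbb{N}$ and $\varepsilon>0$ there is $a_0>0$ such that for every $a\in(0,a_0)$ there is a real-analytic Liouville metric $g$ on $\mathbb{T}^2$ which is $\varepsilon$-close to $g_0$ in $C^k$ (all derivatives of order at most $k$ of the coefficients of $g-g_0$ are less than $\varepsilon$ in norm everywhere), for which $\Phi_a$ is an eigenfunction with eigenvalue $1$, $-\Delta_g\Phi_a=\Phi_a$, and such that the super-level set $\{\Phi_a>1\}\subset\mathbb{T}^2$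 has at least $n$ connected components. (2) If $n\ge 4$, there is $\delta>0$ such that for every $a\in\mathbb{R}$ and every real-analytic Liouville metric $g$ on $\mathbb{T}^2$ that is $\delta$-close to $g_0$ in $C^0$ and for which $\Phi_a$ is an eigenfunction of $-\Delta_g$ with eigenvalue $1$, the eigenvalue $1$ is the second, third or fourth eigenvalue of $-\Delta_g$, that is, $1\in\{\lambda_2(g),\lambda_3(g),\lambda_4(g)\}$. -/

import Mathlib

open scoped ContDiff

noncomputable section

/-- The torus `(ℝ / 2πℤ)²`; `Real.Angle` is `ℝ / 2πℤ` with its quotient topology. -/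
abbrev Torus : Type := Real.Angle × Real.Angle

namespace Torus

/-- The doubly `2π`-periodic function on `ℝ²` that corresponds to a function on the torus. -/
def lift (u : Torus → ℝ) : ℝ × ℝ → ℝ :=
  fun p => u ((p.1 : Real.Angle), (p.2 : Real.Angle))

/-- `C^∞` functions on the torus. -/
def IsSmooth (u : Torus → ℝ) : Prop := ContDiff ℝ ∞ (lift u)

/-- Real analytic functions on the torus. -/
def IsRealAnalytic (u : Torus → ℝ) : Prop := AnalyticOnNhd ℝ (lift u) Set.univ

/-- The coordinate direction `x` (index `0`) or `y` (index `1`), scaled by `t`. -/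
def dir (i : Fin 2) (t : ℝ) : Torus :=
  if i = 0 then ((t : Real.Angle), 0) else (0, (t : Real.Angle))

/-- The partial derivative `∂u/∂x` (index `0`) or `∂u/∂y` (index `1`). -/
def partialDeriv (i : Fin 2) (u : Torus → ℝ) : Torus → ℝ :=
  fun p => deriv (fun t : ℝ => u (p + dir i t)) 0

/-- A smooth Riemannian metric `∑ gᵢⱼ dxᵢ dxⱼ` on the torus, in the global coordinates
`(x, y)`. -/
structure Metric where
  coeff : Torus → Matrix (Fin 2) (Fin 2) ℝ
  smooth : ∀ i j, IsSmooth (fun p => coeff p i j)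
  posDef : ∀ p, (coeff p).PosDef

namespace Metric

/-- The flat metric `dx² + dy²`. -/
def flat : Metric where
  coeff := fun _ => 1
  smooth := fun i j => contDiff_const (c := (1 : Matrix (Fin 2) (Fin 2) ℝ) i j)
  posDef := fun _ => Matrix.PosDef.one

/-- All coefficients of the metric are real analytic. -/
def IsRealAnalytic (g : Metric) : Prop :=
  ∀ i j, Torus.IsRealAnalytic (fun p => g.coeff p i j)

/-- The metric is of the form `Q(x) (dx² + dy²)`. -/
def IsLiouville (g : Metric) : Prop :=
  ∃ Q : Real.Angle → ℝ, ∀ p, g.coeff p = Q p.1 • (1 : Matrix (Fin 2) (Fin 2) ℝ)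

/-- The derivatives of order at most `k` of the coefficients of `g` and `h` differ
by less than `ε` everywhere. -/
def IsCkClose (k : ℕ) (ε : ℝ) (g h : Metric) : Prop :=
  ∀ m ≤ k, ∀ i j, ∀ p : ℝ × ℝ,
    ‖iteratedFDeriv ℝ m (lift (fun q => g.coeff q i j - h.coeff q i j)) p‖ < ε

/-- The Laplace-Beltrami operator
`Δ_g u = (det g)^(-1/2) ∑ᵢⱼ ∂ᵢ ((det g)^(1/2) gⁱʲ ∂ⱼ u)`. -/
def laplaceBeltrami (g : Metric) (u : Torus → ℝ) : Torus → ℝ :=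
  fun p => (Real.sqrt (g.coeff p).det)⁻¹ *
    ∑ i, partialDeriv i
      (fun q => ∑ j, Real.sqrt (g.coeff q).det * (g.coeff q)⁻¹ i j * partialDeriv j u q) p

/-- `u` is an eigenfunction of `-Δ_g` with eigenvalue `μ`. -/
def IsEigenfunction (g : Metric) (μ : ℝ) (u : Torus → ℝ) : Prop :=
  u ≠ 0 ∧ IsSmooth u ∧ ∀ p, -(laplaceBeltrami g u p) = μ * u p

/-- The span of all eigenfunctions of `-Δ_g` whose eigenvalue lies in `s`. -/
def eigenSpan (g : Metric) (s : Set ℝ) : Submodule ℝ (Torus → ℝ) :=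
  Submodule.span ℝ {u | ∃ μ ∈ s, g.IsEigenfunction μ u}

/-- `μ` is the `k`-th eigenvalue `μ_k` of `-Δ_g`, where the eigenvalues `μ₁ ≤ μ₂ ≤ …` are listed in
non-decreasing order, with multiplicities, starting from the label `1`: fewer than `k` eigenvalues
are smaller than `μ`, and at least `k` of them are at most `μ`. -/
def IsKthEigenvalue (g : Metric) (k : ℕ) (μ : ℝ) : Prop :=
  Module.rank ℝ (g.eigenSpan (Set.Iio μ)) < (k : Cardinal) ∧
    (k : Cardinal) ≤ Module.rank ℝ (g.eigenSpan (Set.Iic μ))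

end Metric

/-- The function `(1 + a cos(nx)) cos y`. -/
def trigProduct (n : ℕ) (a : ℝ) : Torus → ℝ :=
  fun p => (1 + a * Real.Angle.cos (n • p.1)) * Real.Angle.cos p.2

/-- The number of connected components of a subset of the torus. -/
def numComponents (S : Set Torus) : ℕ∞ := ENat.card (ConnectedComponents S)

end Torus

end

open scoped ContDiff

noncomputable section

namespace Torus

open MeasureTheory

/-! Since the metric is conformal in dimension two, `-Δ_g u = μ u` is the weighted flat equation
`-Δu = μ Q u`, with Dirichlet energy independent of `Q`.

Existence: solving `-ΔΦ = QΦ` for `Q` gives `Q = 1 + n² s/(1+s)` with `s = a cos(nx)`. This is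
analytic and positive for small `a`, and tends to `1` in every `C^k` as `a → 0`
(`exists_norm_iteratedFDeriv_comp_lt`). Where `Φ > 1`, `cos(nx) > 0`, so dividing `e^{ix}` by the
principal `n`-th root of `e^{inx}` is a locally constant map to the `n`-th roots of unity; it takes
all `n` values (`le_numComponents_trigProduct`).

Label of the eigenvalue: a combination `w` of eigenfunctions with eigenvalues at most `1` has energy
at most its `Q`-weighted norm, hence at most `3/2 ‖w‖²`. If `w` is orthogonal to `1, cos x, sin x,
cos y, sin y`, Parseval gives energy at least `2 ‖w‖²`, so `w = 0`. Thus at most five eigenvalues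
are at most `1` (`rank_eigenSpan_Iic_le`). Constants lie below `1`, and translation in `y` makes the
multiplicity of `1` at least two. So between one and three eigenvalues lie below `1`, and its label
can be taken to be 2, 3 or 4. -/

/-- The coordinate vectors of `ℝ²`. -/
def basisVec (i : Fin 2) : ℝ × ℝ := if i = 0 then (1, 0) else (0, 1)

/-! ### Smooth functions and partial derivatives on the torus -/

lemma IsSmooth.add {u v : Torus → ℝ} (hu : IsSmooth u) (hv : IsSmooth v) : IsSmooth (u + v) :=
  ContDiff.add hu hv

lemma IsSmooth.mul {u v : Torus → ℝ} (hu : IsSmooth u) (hv : IsSmooth v) : IsSmooth (u * v) :=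
  ContDiff.mul hu hv

lemma IsSmooth.smul {u : Torus → ℝ} (c : ℝ) (hu : IsSmooth u) : IsSmooth (c • u) :=
  ContDiff.const_smul c hu

lemma isSmooth_const (c : ℝ) : IsSmooth (fun _ => c) :=
  contDiff_const

lemma exists_coe (p : Torus) : ∃ q : ℝ × ℝ, ((q.1 : Real.Angle), (q.2 : Real.Angle)) = p := by
  obtain ⟨x, y⟩ := p
  induction x using Real.Angle.induction_on with | _ x
  induction y using Real.Angle.induction_on with | _ y
  exact ⟨(x, y), rfl⟩

lemma coe_add_dir (q : ℝ × ℝ) (i : Fin 2) (t : ℝ) :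
    (((q.1 : Real.Angle), (q.2 : Real.Angle)) : Torus) + dir i t =
      (((q + t • basisVec i).1 : Real.Angle), ((q + t • basisVec i).2 : Real.Angle)) := by
  fin_cases i <;> simp [dir, basisVec]

lemma IsSmooth.hasDerivAt_lift {u : Torus → ℝ} (hu : IsSmooth u) (q : ℝ × ℝ) (i : Fin 2) :
    HasDerivAt (fun t : ℝ => u (((q.1 : Real.Angle), (q.2 : Real.Angle)) + dir i t))
      (fderiv ℝ (lift u) q (basisVec i)) 0 := by
  have h : (fun t : ℝ => u (((q.1 : Real.Angle), (q.2 : Real.Angle)) + dir i t)) =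
      fun t => lift u (q + t • basisVec i) := by
    funext t
    rw [coe_add_dir]
    rfl
  rw [h]
  have h1 : HasFDerivAt (lift u) (fderiv ℝ (lift u) q) q :=
    ((ContDiff.differentiable hu (by simp)) q).hasFDerivAt
  exact h1.hasLineDerivAt (basisVec i)

lemma IsSmooth.lift_partialDeriv {u : Torus → ℝ} (hu : IsSmooth u) (i : Fin 2) :
    lift (partialDeriv i u) = fun q => fderiv ℝ (lift u) q (basisVec i) := by
  funext q
  exact (hu.hasDerivAt_lift q i).deriv

lemma IsSmooth.partialDeriv {u : Torus → ℝ} (hu : IsSmooth u) (i : Fin 2) :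
    IsSmooth (partialDeriv i u) := by
  unfold IsSmooth
  rw [hu.lift_partialDeriv i]
  exact (ContDiff.fderiv_right (m := ∞) hu (by simp)).clm_apply contDiff_const

lemma IsSmooth.hasDerivAt {u : Torus → ℝ} (hu : IsSmooth u) (p : Torus) (i : Fin 2) :
    HasDerivAt (fun t : ℝ => u (p + dir i t)) (Torus.partialDeriv i u p) 0 := by
  obtain ⟨q, rfl⟩ := exists_coe p
  exact (hu.hasDerivAt_lift q i).differentiableAt.hasDerivAt

lemma dir_zero (i : Fin 2) : dir i 0 = 0 := by
  fin_cases i <;> simp [dir]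

lemma partialDeriv_mul {u v : Torus → ℝ} (hu : IsSmooth u) (hv : IsSmooth v) (i : Fin 2) :
    partialDeriv i (u * v) = partialDeriv i u * v + u * partialDeriv i v := by
  funext p
  have := ((hu.hasDerivAt p i).mul (hv.hasDerivAt p i)).deriv
  simp only [dir_zero, add_zero] at this
  exact this

lemma partialDeriv_add {u v : Torus → ℝ} (hu : IsSmooth u) (hv : IsSmooth v) (i : Fin 2) :
    partialDeriv i (u + v) = partialDeriv i u + partialDeriv i v := by
  funext p
  exact ((hu.hasDerivAt p i).add (hv.hasDerivAt p i)).deriv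

lemma partialDeriv_smul {u : Torus → ℝ} (c : ℝ) (hu : IsSmooth u) (i : Fin 2) :
    partialDeriv i (c • u) = c • partialDeriv i u := by
  funext p
  exact ((hu.hasDerivAt p i).const_smul c).deriv

lemma partialDeriv_translate (u : Torus → ℝ) (q : Torus) (i : Fin 2) :
    partialDeriv i (fun p => u (p + q)) = fun p => partialDeriv i u (p + q) := by
  funext p
  simp only [partialDeriv, add_right_comm]

/-! ### Averages over the torus -/

/-- The average of a function over the torus. -/
def mean (u : Torus → ℝ) : ℝ :=
  ∫ p in Set.Ioc (0 : ℝ) 1 ×ˢ Set.Ioc (0 : ℝ) 1, lift u ((2 * Real.pi) • p)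

lemma integrableOn_lift {u : Torus → ℝ} (hu : Continuous (lift u)) :
    IntegrableOn (fun p => lift u ((2 * Real.pi) • p))
      (Set.Ioc (0 : ℝ) 1 ×ˢ Set.Ioc (0 : ℝ) 1) := by
  have : IntegrableOn (fun p => lift u ((2 * Real.pi) • p))
      (Set.Icc (0 : ℝ) 1 ×ˢ Set.Icc (0 : ℝ) 1) :=
    (hu.comp (continuous_const_smul _)).continuousOn.integrableOn_compact
      (isCompact_Icc.prod isCompact_Icc)
  exact this.mono_set (Set.prod_mono Set.Ioc_subset_Icc_self Set.Ioc_subset_Icc_self)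

lemma mean_add {u v : Torus → ℝ} (hu : Continuous (lift u)) (hv : Continuous (lift v)) :
    mean (u + v) = mean u + mean v :=
  integral_add (integrableOn_lift hu) (integrableOn_lift hv)

lemma mean_smul (c : ℝ) (u : Torus → ℝ) : mean (c • u) = c * mean u :=
  integral_const_mul c _

lemma mean_mono {u v : Torus → ℝ} (hu : Continuous (lift u)) (hv : Continuous (lift v))
    (h : ∀ p, u p ≤ v p) : mean u ≤ mean v :=
  integral_mono (integrableOn_lift hu) (integrableOn_lift hv) fun _ => h _

lemma mean_nonneg {u : Torus → ℝ} (h : ∀ p, 0 ≤ u p) : 0 ≤ mean u :=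
  integral_nonneg fun _ => h _

/-- The integral of a partial derivative vanishes. -/
lemma mean_partialDeriv {u : Torus → ℝ} (hu : IsSmooth u) (i : Fin 2) :
    mean (partialDeriv i u) = 0 := by
  have hint := integrableOn_lift (hu.partialDeriv i).continuous
  have hderiv : ∀ (q : ℝ × ℝ) (s : ℝ),
      HasDerivAt (fun s : ℝ => lift u ((2 * Real.pi) • (q + s • basisVec i)))
        ((2 * Real.pi) * lift (partialDeriv i u) ((2 * Real.pi) • (q + s • basisVec i))) s := by
    intro q s
    rw [hu.lift_partialDeriv i]
    have h1 : HasFDerivAt (lift u) (fderiv ℝ (lift u) ((2 * Real.pi) • (q + s • basisVec i)))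
        ((2 * Real.pi) • (q + s • basisVec i)) :=
      ((ContDiff.differentiable hu (by simp)) _).hasFDerivAt
    have h2 : HasDerivAt (fun s : ℝ => (2 * Real.pi) • (q + s • basisVec i))
        ((2 * Real.pi) • ((1 : ℝ) • basisVec i)) s :=
      (((hasDerivAt_id s).smul_const (basisVec i)).const_add q).const_smul (2 * Real.pi)
    have h3 := h1.comp_hasDerivAt s h2
    rw [one_smul, map_smul, smul_eq_mul] at h3
    exact h3
  have hcont := (hu.partialDeriv i).continuous
  -- A full period in direction `i` returns to the same point, so the fundamental theorem of
  -- calculus gives zero; Fubini then integrates in that direction first.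
  have hzero : ∀ q : ℝ × ℝ, ∫ s in Set.Ioc (0 : ℝ) 1,
      lift (partialDeriv i u) ((2 * Real.pi) • (q + s • basisVec i)) = 0 := by
    intro q
    have h := intervalIntegral.integral_eq_sub_of_hasDerivAt (a := 0) (b := 1)
      (fun s _ => hderiv q s)
      (Continuous.intervalIntegrable (by fun_prop) _ _)
    have hper : lift u ((2 * Real.pi) • (q + (1 : ℝ) • basisVec i)) =
        lift u ((2 * Real.pi) • (q + (0 : ℝ) • basisVec i)) := by
      fin_cases i <;> simp [lift, basisVec]
    rw [hper, sub_self, intervalIntegral.integral_const_mul,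
      intervalIntegral.integral_of_le zero_le_one] at h
    exact (mul_eq_zero.mp h).resolve_left (by positivity)
  unfold mean
  rw [Measure.volume_eq_prod] at hint ⊢
  fin_cases i
  · rw [← setIntegral_prod_swap]
    refine (setIntegral_prod _ hint.swap).trans ?_
    have : ∀ y ∈ Set.Ioc (0 : ℝ) 1, ∫ x in Set.Ioc (0 : ℝ) 1,
        lift (partialDeriv 0 u) ((2 * Real.pi) • (x, y)) = 0 := by
      intro y _
      simpa [basisVec] using hzero (0, y)
    exact setIntegral_eq_zero_of_forall_eq_zero this
  · rw [setIntegral_prod _ hint]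
    have : ∀ x ∈ Set.Ioc (0:ℝ) 1, ∫ y in Set.Ioc (0 : ℝ) 1,
      lift (partialDeriv 1 u) ((2 * Real.pi) • (x, y)) = 0 := by
      intro x _
      simpa [basisVec] using hzero (x, 0)
    exact setIntegral_eq_zero_of_forall_eq_zero this

/-! ### Fourier modes and integration by parts -/

/-- The function `cos (m₀ x + m₁ y)` on the torus. -/
def cosMode (m : Fin 2 → ℤ) : Torus → ℝ := fun p => Real.Angle.cos (m 0 • p.1 + m 1 • p.2)

/-- The function `sin (m₀ x + m₁ y)` on the torus. -/
def sinMode (m : Fin 2 → ℤ) : Torus → ℝ := fun p => Real.Angle.sin (m 0 • p.1 + m 1 • p.2)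

lemma lift_cosMode (m : Fin 2 → ℤ) :
    lift (cosMode m) = fun p => Real.cos (m 0 * p.1 + m 1 * p.2) := by
  funext p
  simp [lift, cosMode, ← Real.Angle.intCast_mul_eq_zsmul, ← Real.Angle.coe_add]

lemma lift_sinMode (m : Fin 2 → ℤ) :
    lift (sinMode m) = fun p => Real.sin (m 0 * p.1 + m 1 * p.2) := by
  funext p
  simp [lift, sinMode, ← Real.Angle.intCast_mul_eq_zsmul, ← Real.Angle.coe_add]

lemma isSmooth_cosMode (m : Fin 2 → ℤ) : IsSmooth (cosMode m) := by
  unfold IsSmooth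
  rw [lift_cosMode]
  fun_prop

lemma isSmooth_sinMode (m : Fin 2 → ℤ) : IsSmooth (sinMode m) := by
  unfold IsSmooth
  rw [lift_sinMode]
  fun_prop

lemma lift_injective : Function.Injective lift := by
  intro u v h
  funext p
  obtain ⟨q, rfl⟩ := exists_coe p
  exact congrFun h q

lemma partialDeriv_cosMode (m : Fin 2 → ℤ) (i : Fin 2) :
    partialDeriv i (cosMode m) = (-(m i : ℝ)) • sinMode m := by
  apply lift_injective
  rw [(isSmooth_cosMode m).lift_partialDeriv i]
  funext q
  have h := (((hasFDerivAt_fst (𝕜 := ℝ) (p := q)).const_mul (m 0 : ℝ)).add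
    ((hasFDerivAt_snd (𝕜 := ℝ) (p := q)).const_mul (m 1 : ℝ))).cos
  rw [lift_cosMode]
  refine (congrArg (fun L => L (basisVec i)) h.fderiv).trans ?_
  change _ = -(m i : ℝ) * lift (sinMode m) q
  rw [lift_sinMode]
  fin_cases i <;> simp [basisVec] <;> ring

lemma partialDeriv_sinMode (m : Fin 2 → ℤ) (i : Fin 2) :
    partialDeriv i (sinMode m) = (m i : ℝ) • cosMode m := by
  apply lift_injective
  rw [(isSmooth_sinMode m).lift_partialDeriv i]
  funext q
  have h := (((hasFDerivAt_fst (𝕜 := ℝ) (p := q)).const_mul (m 0 : ℝ)).add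
    ((hasFDerivAt_snd (𝕜 := ℝ) (p := q)).const_mul (m 1 : ℝ))).sin
  rw [lift_sinMode]
  refine (congrArg (fun L => L (basisVec i)) h.fderiv).trans ?_
  change _ = (m i : ℝ) * lift (cosMode m) q
  rw [lift_cosMode]
  fin_cases i <;> simp [basisVec] <;> ring

/-- Integration by parts on the torus. -/
lemma mean_mul_partialDeriv {u v : Torus → ℝ} (hu : IsSmooth u) (hv : IsSmooth v) (i : Fin 2) :
    mean (u * partialDeriv i v) = -mean (partialDeriv i u * v) := by
  have h := mean_partialDeriv (hu.mul hv) i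
  rw [partialDeriv_mul hu hv, mean_add ((hu.partialDeriv i).mul hv).continuous
    (hu.mul (hv.partialDeriv i)).continuous] at h
  linarith

/-! ### Parseval's identity -/

section Parseval

/-- The circle with its probability Haar measure. -/
local instance : MeasureSpace UnitAddCircle := ⟨AddCircle.haarAddCircle⟩

local instance : Measure.IsAddHaarMeasure (volume : Measure UnitAddCircle) :=
  inferInstanceAs (Measure.IsAddHaarMeasure AddCircle.haarAddCircle)

local instance : IsProbabilityMeasure (volume : Measure UnitAddCircle) :=
  inferInstanceAs (IsProbabilityMeasure AddCircle.haarAddCircle)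

/-- The rescaling of `(ℝ / ℤ)²` to the torus `(ℝ / 2πℤ)²`. -/
def ofUnitTorus (x : UnitAddTorus (Fin 2)) : Torus :=
  (AddCircle.homeomorphAddCircle 1 (2 * Real.pi) one_ne_zero Real.two_pi_pos.ne' (x 0),
   AddCircle.homeomorphAddCircle 1 (2 * Real.pi) one_ne_zero Real.two_pi_pos.ne' (x 1))

lemma continuous_ofUnitTorus : Continuous ofUnitTorus := by
  refine Continuous.prodMk ?_ ?_
  · exact (Homeomorph.continuous _).comp (continuous_apply 0)
  · exact (Homeomorph.continuous _).comp (continuous_apply 1)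

lemma ofUnitTorus_coe (x : Fin 2 → ℝ) :
    ofUnitTorus (fun i => (x i : UnitAddCircle)) =
      (((2 * Real.pi * x 0 : ℝ) : Real.Angle), ((2 * Real.pi * x 1 : ℝ) : Real.Angle)) := by
  unfold ofUnitTorus
  rw [AddCircle.homeomorphAddCircle_apply_mk, AddCircle.homeomorphAddCircle_apply_mk]
  rw [inv_one, one_mul, mul_comm (x 0), mul_comm (x 1)]
  rfl

/-- Products of open quotient maps are quotient maps, so continuity descends from the plane. -/
lemma continuous_of_lift {u : Torus → ℝ} (hu : Continuous (lift u)) : Continuous u := by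
  have h : IsOpenQuotientMap ((↑) : ℝ → Real.Angle) := QuotientAddGroup.isOpenQuotientMap_mk
  exact (h.prodMap h).isQuotientMap.continuous_iff.mpr hu

lemma integral_unitTorus {E : Type*} [NormedAddCommGroup E] [NormedSpace ℝ E]
    (F : UnitAddTorus (Fin 2) → E) :
    ∫ x, F x = ∫ p in Set.Ioc (0 : ℝ) 1 ×ˢ Set.Ioc (0 : ℝ) 1,
      F (fun i => ((![p.1, p.2] i : ℝ) : UnitAddCircle)) := by
  rw [UnitAddTorus.integral_preimage F 0,
    ← (volume_preserving_finTwoArrow ℝ).symm.setIntegral_preimage_emb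
      (MeasurableEquiv.measurableEmbedding _)]
  have : (MeasurableEquiv.finTwoArrow (α := ℝ)).symm ⁻¹'
      {x | ∀ i, x i ∈ Set.Ioc ((0 : Fin 2 → ℝ) i) ((0 : Fin 2 → ℝ) i + 1)} =
      Set.Ioc (0 : ℝ) 1 ×ˢ Set.Ioc (0 : ℝ) 1 := by
    ext p
    simp [Fin.forall_fin_two, MeasurableEquiv.finTwoArrow]
  rw [this]
  rfl

lemma integral_ofUnitTorus (u : Torus → ℝ) : ∫ x, u (ofUnitTorus x) = mean u := by
  rw [integral_unitTorus]
  unfold mean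
  congr 1
  funext p
  rw [ofUnitTorus_coe]
  rfl

/-- For real `u`, this makes the cosine and sine averages the real part and minus the imaginary part
of the complex Fourier coefficient. -/
lemma mFourier_neg_eq (m : Fin 2 → ℤ) (x : UnitAddTorus (Fin 2)) :
    UnitAddTorus.mFourier (-m) x =
      (cosMode m (ofUnitTorus x) : ℂ) - (sinMode m (ofUnitTorus x) : ℂ) * Complex.I := by
  obtain ⟨y, rfl⟩ : ∃ y : Fin 2 → ℝ, (fun i => (y i : UnitAddCircle)) = x := by
    choose y hy using fun i => QuotientAddGroup.mk_surjective (x i)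
    exact ⟨y, funext hy⟩
  rw [ofUnitTorus_coe]
  have h1 : cosMode m (((2 * Real.pi * y 0 : ℝ) : Real.Angle),
      ((2 * Real.pi * y 1 : ℝ) : Real.Angle)) = _ :=
    congrFun (lift_cosMode m) (2 * Real.pi * y 0, 2 * Real.pi * y 1)
  have h2 : sinMode m (((2 * Real.pi * y 0 : ℝ) : Real.Angle),
      ((2 * Real.pi * y 1 : ℝ) : Real.Angle)) = _ :=
    congrFun (lift_sinMode m) (2 * Real.pi * y 0, 2 * Real.pi * y 1)
  rw [h1, h2]
  simp only [UnitAddTorus.mFourier, ContinuousMap.coe_mk, Fin.prod_univ_two, fourier_coe_apply,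
    ← Complex.exp_add, Complex.ofReal_cos, Complex.ofReal_sin]
  rw [Complex.cos_sub_sin_I]
  congr 1
  push_cast [Pi.neg_apply]
  ring

/-- Parseval's identity for the real Fourier coefficients of a function on the torus. -/
lemma hasSum_sq_modes {u : Torus → ℝ} (hu : Continuous (lift u)) :
    HasSum (fun m : Fin 2 → ℤ => mean (cosMode m * u) ^ 2 + mean (sinMode m * u) ^ 2)
      (mean (u * u)) := by
  have huc := continuous_of_lift hu
  let W : C(UnitAddTorus (Fin 2), ℂ) :=
    ⟨fun x => (u (ofUnitTorus x) : ℂ),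
      Complex.continuous_ofReal.comp (huc.comp continuous_ofUnitTorus)⟩
  have h := UnitAddTorus.hasSum_sq_mFourierCoeff (ContinuousMap.toLp 2 volume ℂ W)
  have hW : ∫ t, ‖ContinuousMap.toLp 2 volume ℂ W t‖ ^ 2 = mean (u * u) := by
    rw [← integral_ofUnitTorus]
    refine integral_congr_ae ?_
    filter_upwards [ContinuousMap.coeFn_toLp (p := 2) (𝕜 := ℂ) volume W] with t ht
    rw [ht]
    simp [W, pow_two]
  rw [hW] at h
  refine h.congr_fun fun m => ?_
  rw [UnitAddTorus.mFourierCoeff_toLp, UnitAddTorus.mFourierCoeff]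
  have hc : Integrable fun x => (cosMode m * u) (ofUnitTorus x) :=
    (((continuous_of_lift (isSmooth_cosMode m).continuous).mul huc).comp
      continuous_ofUnitTorus).integrable_of_hasCompactSupport (.of_compactSpace _)
  have hs : Integrable fun x => (sinMode m * u) (ofUnitTorus x) :=
    (((continuous_of_lift (isSmooth_sinMode m).continuous).mul huc).comp
      continuous_ofUnitTorus).integrable_of_hasCompactSupport (.of_compactSpace _)
  have e : (fun t => UnitAddTorus.mFourier (-m) t • W t) = fun t =>
      (((cosMode m * u) (ofUnitTorus t) : ℝ) : ℂ) -
        (((sinMode m * u) (ofUnitTorus t) : ℝ) : ℂ) * Complex.I := by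
    funext t
    rw [mFourier_neg_eq]
    simp [W]
    ring
  rw [e, integral_sub hc.ofReal (hs.ofReal.mul_const _), integral_mul_const,
    integral_complex_ofReal, integral_complex_ofReal, integral_ofUnitTorus, integral_ofUnitTorus,
    ← Complex.normSq_eq_norm_sq, Complex.normSq_apply]
  simp
  ring

lemma ofUnitTorus_surjective : Function.Surjective ofUnitTorus := fun p =>
  ⟨![(AddCircle.homeomorphAddCircle 1 (2 * Real.pi) one_ne_zero Real.two_pi_pos.ne').symm p.1,
    (AddCircle.homeomorphAddCircle 1 (2 * Real.pi) one_ne_zero Real.two_pi_pos.ne').symm p.2],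
    Prod.ext (Homeomorph.apply_symm_apply _ _) (Homeomorph.apply_symm_apply _ _)⟩

/-- A continuous nonnegative function that is positive somewhere has positive integral. -/
lemma eq_zero_of_mean_mul_self {u : Torus → ℝ} (hu : Continuous (lift u))
    (h : mean (u * u) ≤ 0) : u = 0 := by
  have huc := (continuous_of_lift hu).comp continuous_ofUnitTorus
  by_contra hne
  obtain ⟨p, hp⟩ := Function.ne_iff.mp hne
  obtain ⟨x, rfl⟩ := ofUnitTorus_surjective p
  rw [← integral_ofUnitTorus] at h
  refine absurd h (not_le.mpr ?_)
  refine Continuous.integral_pos_of_hasCompactSupport_nonneg_nonzero (x := x)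
    (huc.mul huc) (.of_compactSpace _) (fun t => mul_self_nonneg _) ?_
  exact mul_self_ne_zero.mpr hp

end Parseval

/-- A function orthogonal to the eigenfunctions of the flat Laplacian with eigenvalue at most `1`
satisfies the Poincaré inequality with constant `2`. -/
lemma two_mul_mean_sq_le {u : Torus → ℝ} (hu : IsSmooth u)
    (h : ∀ m : Fin 2 → ℤ, m 0 ^ 2 + m 1 ^ 2 ≤ 1 →
      mean (cosMode m * u) = 0 ∧ mean (sinMode m * u) = 0) :
    2 * mean (u * u) ≤ mean (partialDeriv 0 u * partialDeriv 0 u) +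
      mean (partialDeriv 1 u * partialDeriv 1 u) := by
  have h0 := hasSum_sq_modes (hu.partialDeriv 0).continuous
  have h1 := hasSum_sq_modes (hu.partialDeriv 1).continuous
  refine hasSum_le (fun m => ?_) ((hasSum_sq_modes hu.continuous).mul_left 2) (h0.add h1)
  -- Differentiation in direction `i` multiplies the coefficients by `±m i` and swaps sine with
  -- cosine.
  have hc : ∀ i, mean (cosMode m * partialDeriv i u) = m i * mean (sinMode m * u) := by
    intro i
    rw [mean_mul_partialDeriv (isSmooth_cosMode m) hu, partialDeriv_cosMode, smul_mul_assoc,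
      mean_smul]
    ring
  have hs : ∀ i, mean (sinMode m * partialDeriv i u) = -(m i * mean (cosMode m * u)) := by
    intro i
    rw [mean_mul_partialDeriv (isSmooth_sinMode m) hu, partialDeriv_sinMode, smul_mul_assoc,
      mean_smul]
  simp only [hc, hs]
  by_cases hm : m 0 ^ 2 + m 1 ^ 2 ≤ 1
  · simp [h m hm]
  -- `|m|²` is an integer, so the first flat eigenvalue above `1` is at least `2`.
  · have hm' : (2 : ℝ) ≤ (m 0 : ℝ) ^ 2 + (m 1 : ℝ) ^ 2 := by
      exact_mod_cast (show (2 : ℤ) ≤ _ by omega)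
    nlinarith [mul_le_mul_of_nonneg_right hm'
      (add_nonneg (sq_nonneg (mean (cosMode m * u))) (sq_nonneg (mean (sinMode m * u))))]

/-! ### The weighted flat eigenvalue problem -/

/-- The Laplacian of the flat metric. -/
def flatLaplacian (u : Torus → ℝ) : Torus → ℝ :=
  partialDeriv 0 (partialDeriv 0 u) + partialDeriv 1 (partialDeriv 1 u)

lemma flatLaplacian_add {u v : Torus → ℝ} (hu : IsSmooth u) (hv : IsSmooth v) :
    flatLaplacian (u + v) = flatLaplacian u + flatLaplacian v := by
  simp only [flatLaplacian, partialDeriv_add hu hv,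
    partialDeriv_add (hu.partialDeriv _) (hv.partialDeriv _)]
  abel

lemma flatLaplacian_smul (c : ℝ) {u : Torus → ℝ} (hu : IsSmooth u) :
    flatLaplacian (c • u) = c • flatLaplacian u := by
  simp only [flatLaplacian, partialDeriv_smul c hu, partialDeriv_smul c (hu.partialDeriv _),
    smul_add]

lemma partialDeriv_const (i : Fin 2) (c : ℝ) : partialDeriv i (fun _ => c) = 0 := by
  funext p
  simp [partialDeriv]

/-- The smooth functions on the torus. -/
def smoothFunctions : Submodule ℝ (Torus → ℝ) where
  carrier := {u | IsSmooth u}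
  zero_mem' := isSmooth_const 0
  add_mem' hu hv := hu.add hv
  smul_mem' c _ hu := hu.smul c

/-- The solutions of `-Δu = μ q u`, for the flat Laplacian and a weight `q`. -/
def weightedEigenspace (q : Torus → ℝ) (μ : ℝ) : Submodule ℝ (Torus → ℝ) where
  carrier := {u | IsSmooth u ∧ flatLaplacian u = (-μ) • (q * u)}
  zero_mem' := by
    refine ⟨isSmooth_const 0, ?_⟩
    have := flatLaplacian_smul 0 (isSmooth_const 0)
    rw [zero_smul, zero_smul] at this
    rw [this, mul_zero, smul_zero]
  add_mem' := by
    rintro u v ⟨hu, hu'⟩ ⟨hv, hv'⟩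
    refine ⟨hu.add hv, ?_⟩
    rw [flatLaplacian_add hu hv, hu', hv', mul_add, smul_add]
  smul_mem' := by
    rintro c u ⟨hu, hu'⟩
    refine ⟨hu.smul c, ?_⟩
    rw [flatLaplacian_smul c hu, hu', mul_smul_comm, smul_comm]

/-- The polarized Dirichlet energy for the flat metric. -/
def energy (u v : Torus → ℝ) : ℝ :=
  mean (partialDeriv 0 u * partialDeriv 0 v) + mean (partialDeriv 1 u * partialDeriv 1 v)

lemma energy_comm (u v : Torus → ℝ) : energy u v = energy v u := by
  simp only [energy, mul_comm]

lemma energy_add_left {u v w : Torus → ℝ} (hu : IsSmooth u) (hv : IsSmooth v) (hw : IsSmooth w) :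
    energy (u + v) w = energy u w + energy v w := by
  simp only [energy, partialDeriv_add hu hv, add_mul]
  rw [mean_add, mean_add]
  · ring
  all_goals exact ((IsSmooth.partialDeriv ‹_› _).mul (hw.partialDeriv _)).continuous

lemma mean_neg (u : Torus → ℝ) : mean (-u) = -mean u := by
  have := mean_smul (-1) u
  rwa [neg_one_smul, neg_one_mul] at this

/-- Green's identity for a solution of `-Δv = μ q v`. -/
lemma energy_eq {q : Torus → ℝ} {μ : ℝ} {u v : Torus → ℝ} (hu : IsSmooth u)
    (hv : v ∈ weightedEigenspace q μ) : energy u v = μ * mean (q * (u * v)) := by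
  have h0 := mean_mul_partialDeriv hu (hv.1.partialDeriv 0) 0
  have h1 := mean_mul_partialDeriv hu (hv.1.partialDeriv 1) 1
  have h : mean (u * flatLaplacian v) = -energy u v := by
    rw [flatLaplacian, mul_add, mean_add, h0, h1, energy]
    · ring
    all_goals exact (hu.mul ((hv.1.partialDeriv _).partialDeriv _)).continuous
  rw [hv.2, mul_smul_comm, mean_smul, mul_left_comm] at h
  linarith

/-- Solutions with distinct eigenvalues are orthogonal for the weighted inner product. -/
lemma mean_mul_eq_zero {q : Torus → ℝ} {μ ν : ℝ} {u v : Torus → ℝ} (hμν : μ ≠ ν)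
    (hu : u ∈ weightedEigenspace q μ) (hv : v ∈ weightedEigenspace q ν) :
    mean (q * (u * v)) = 0 := by
  have h1 := energy_eq hu.1 hv
  rw [energy_comm, energy_eq hv.1 hu, mul_comm v u] at h1
  have : (μ - ν) * mean (q * (u * v)) = 0 := by linarith
  exact (mul_eq_zero.mp this).resolve_left (sub_ne_zero.mpr hμν)

lemma sum_mem_smoothFunctions {q : Torus → ℝ} {f : ℝ → Torus → ℝ}
    (hf : ∀ μ, f μ ∈ weightedEigenspace q μ) (t : Finset ℝ) : IsSmooth (∑ μ ∈ t, f μ) :=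
  smoothFunctions.sum_mem fun μ _ => (hf μ).1

lemma mean_sum_mul_eq_zero {q : Torus → ℝ} (hq : IsSmooth q) {f : ℝ → Torus → ℝ}
    (hf : ∀ μ, f μ ∈ weightedEigenspace q μ) {t : Finset ℝ} {ν : ℝ} (hν : ν ∉ t) {v : Torus → ℝ}
    (hv : v ∈ weightedEigenspace q ν) : mean (q * ((∑ μ ∈ t, f μ) * v)) = 0 := by
  induction t using Finset.induction_on with
  | empty =>
    rw [Finset.sum_empty, zero_mul, mul_zero]
    simp [mean, lift]
  | insert μ t hμ ih =>
    rw [Finset.mem_insert, not_or] at hν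
    rw [Finset.sum_insert hμ, add_mul, mul_add, mean_add, ih hν.2,
      mean_mul_eq_zero (Ne.symm hν.1) (hf μ) hv, add_zero]
    · exact (hq.mul ((hf μ).1.mul hv.1)).continuous
    · exact (hq.mul ((sum_mem_smoothFunctions hf t).mul hv.1)).continuous

/-- A combination of solutions with eigenvalues at most `1` has energy at most its weighted
norm. -/
lemma energy_sum_le {q : Torus → ℝ} (hq : IsSmooth q) (hq0 : ∀ p, 0 ≤ q p) {f : ℝ → Torus → ℝ}
    (hf : ∀ μ, f μ ∈ weightedEigenspace q μ) {t : Finset ℝ} (ht : ∀ μ ∈ t, μ ≤ 1) :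
    energy (∑ μ ∈ t, f μ) (∑ μ ∈ t, f μ) ≤
      mean (q * ((∑ μ ∈ t, f μ) * (∑ μ ∈ t, f μ))) := by
  induction t using Finset.induction_on with
  | empty => simp [energy, mean, lift, partialDeriv]
  | insert μ t hμ ih =>
    have hw := sum_mem_smoothFunctions hf t
    have hu := (hf μ).1
    have horth := mean_sum_mul_eq_zero hq hf hμ (hf μ)
    -- Orthogonality for the weight also kills the cross term of the energy, so both quadratic forms
    -- split.
    have hcross : energy (∑ μ ∈ t, f μ) (f μ) = 0 := by
      rw [energy_eq hw (hf μ), horth, mul_zero]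
    have ih := ih fun ν hν => ht ν (Finset.mem_insert_of_mem hν)
    rw [Finset.sum_insert hμ]
    set w := ∑ μ ∈ t, f μ
    have h1 : energy (f μ + w) (f μ + w) = μ * mean (q * (f μ * f μ)) + energy w w := by
      rw [energy_add_left hu hw (hu.add hw), energy_comm, energy_comm w,
        energy_add_left hu hw hu, energy_add_left hu hw hw, hcross, energy_comm _ w, hcross,
        energy_eq hu (hf μ)]
      ring
    have h2 : mean (q * ((f μ + w) * (f μ + w))) =
        mean (q * (f μ * f μ)) + mean (q * (w * w)) := by
      have e : q * ((f μ + w) * (f μ + w)) =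
          q * (f μ * f μ) + (q * (w * w) + (2 : ℝ) • (q * (w * f μ))) := by
        funext p
        simp
        ring
      rw [e, mean_add (hq.mul (hu.mul hu)).continuous
          ((hq.mul (hw.mul hw)).add ((hq.mul (hw.mul hu)).smul 2)).continuous,
        mean_add (hq.mul (hw.mul hw)).continuous ((hq.mul (hw.mul hu)).smul 2).continuous,
        mean_smul, horth]
      ring
    have h3 : 0 ≤ mean (q * (f μ * f μ)) :=
      mean_nonneg fun p => mul_nonneg (hq0 p) (mul_self_nonneg _)
    have h4 := mul_le_mul_of_nonneg_right (ht μ (Finset.mem_insert_self _ _)) h3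
    rw [h1, h2]
    linarith

/-! ### From Liouville metrics to the weighted problem -/

namespace Metric

variable {g : Metric} {Q : Real.Angle → ℝ}

lemma conformalFactor_pos (hQ : ∀ p, g.coeff p = Q p.1 • (1 : Matrix (Fin 2) (Fin 2) ℝ))
    (p : Torus) : 0 < Q p.1 := by
  have := (g.posDef p).diag_pos (i := 0)
  simpa [hQ] using this

lemma isSmooth_conformalFactor
    (hQ : ∀ p, g.coeff p = Q p.1 • (1 : Matrix (Fin 2) (Fin 2) ℝ)) :
    IsSmooth (fun p => Q p.1) := by
  have := g.smooth 0 0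
  simpa [hQ] using this

/-- In dimension two the factors of `Q` in `√det g` and the inverse metric cancel, leaving only the
outer `Q⁻¹`. -/
lemma laplaceBeltrami_eq (hQ : ∀ p, g.coeff p = Q p.1 • (1 : Matrix (Fin 2) (Fin 2) ℝ))
    (u : Torus → ℝ) (p : Torus) :
    g.laplaceBeltrami u p = (Q p.1)⁻¹ * flatLaplacian u p := by
  have hdet : ∀ p, Real.sqrt (g.coeff p).det = Q p.1 := by
    intro p
    rw [hQ, Matrix.det_smul, Matrix.det_one, mul_one, Fintype.card_fin]
    exact Real.sqrt_sq (conformalFactor_pos hQ p).le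
  have hinv : ∀ p, (g.coeff p)⁻¹ = (Q p.1)⁻¹ • (1 : Matrix (Fin 2) (Fin 2) ℝ) := by
    intro p
    refine Matrix.inv_eq_right_inv ?_
    rw [hQ, smul_mul_smul_comm, mul_inv_cancel₀ (conformalFactor_pos hQ p).ne', one_smul, one_mul]
  have hcancel : ∀ p : Torus, Q p.1 * (Q p.1)⁻¹ = 1 := fun p =>
    mul_inv_cancel₀ (conformalFactor_pos hQ p).ne'
  simp [laplaceBeltrami, hdet, hinv, hcancel, flatLaplacian, Fin.sum_univ_two]

lemma isEigenfunction_iff (hQ : ∀ p, g.coeff p = Q p.1 • (1 : Matrix (Fin 2) (Fin 2) ℝ))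
    {μ : ℝ} {u : Torus → ℝ} :
    g.IsEigenfunction μ u ↔ u ≠ 0 ∧ u ∈ weightedEigenspace (fun p => Q p.1) μ := by
  refine and_congr_right fun _ => and_congr_right fun _ => ?_
  rw [funext_iff]
  refine forall_congr' fun p => ?_
  have hp := (conformalFactor_pos hQ p).ne'
  rw [laplaceBeltrami_eq hQ]
  simp only [Pi.smul_apply, Pi.mul_apply, smul_eq_mul]
  constructor
  · intro h
    field_simp at h
    linarith
  · intro h
    rw [h]
    field_simp

/-- Grouping terms by eigenvalue leaves one summand per eigenvalue, hence mutually orthogonal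
summands for the weight. -/
lemma exists_sum_of_mem_eigenSpan
    (hQ : ∀ p, g.coeff p = Q p.1 • (1 : Matrix (Fin 2) (Fin 2) ℝ)) {s : Set ℝ} {w : Torus → ℝ}
    (hw : w ∈ g.eigenSpan s) :
    ∃ f : ℝ →₀ (Torus → ℝ), (∀ μ, f μ ∈ weightedEigenspace (fun p => Q p.1) μ) ∧
      (↑f.support ⊆ s) ∧ w = ∑ μ ∈ f.support, f μ := by
  classical
  induction hw using Submodule.span_induction with
  | mem u hu =>
    obtain ⟨μ, hμ, hu⟩ := hu
    rw [isEigenfunction_iff hQ] at hu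
    refine ⟨Finsupp.single μ u, fun ν => ?_, ?_, ?_⟩
    · by_cases h : μ = ν
      · subst h
        simpa using hu.2
      · rw [Finsupp.single_eq_of_ne (Ne.symm h)]
        exact zero_mem _
    · rw [Finsupp.support_single _ hu.1]
      simpa using hμ
    · exact (Finsupp.sum_single_index (h := fun _ x => x) rfl).symm
  | zero => exact ⟨0, fun μ => zero_mem _, by simp, by simp⟩
  | add u v _ _ hu hv =>
    obtain ⟨f, hf, hfs, rfl⟩ := hu
    obtain ⟨f', hf', hfs', rfl⟩ := hv
    refine ⟨f + f', fun μ => add_mem (hf μ) (hf' μ), ?_, ?_⟩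
    · refine (Finset.coe_subset.mpr Finsupp.support_add).trans ?_
      rw [Finset.coe_union]
      exact Set.union_subset hfs hfs'
    · exact (Finsupp.sum_add_index' (h := fun _ x => x) (fun _ => rfl) fun _ _ _ => rfl).symm
  | smul c u _ hu =>
    obtain ⟨f, hf, hfs, rfl⟩ := hu
    refine ⟨c • f, fun μ => (weightedEigenspace _ μ).smul_mem c (hf μ), ?_, ?_⟩
    · exact (Finset.coe_subset.mpr Finsupp.support_smul).trans hfs
    · rw [Finset.smul_sum]
      exact (Finsupp.sum_smul_index' (h := fun _ x => x) fun _ => rfl).symm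

lemma eigenSpan_le_smoothFunctions (s : Set ℝ) : g.eigenSpan s ≤ smoothFunctions := by
  refine Submodule.span_le.mpr ?_
  rintro u ⟨μ, _, hu⟩
  exact hu.2.1

end Metric

/-! ### Counting the eigenvalues up to `1` -/

/-- Integration against a fixed smooth function. -/
def meanMul (v : smoothFunctions) : smoothFunctions →ₗ[ℝ] ℝ where
  toFun u := mean (v.1 * u.1)
  map_add' u w := by
    rw [Submodule.coe_add, mul_add,
      mean_add (IsSmooth.mul v.2 u.2).continuous (IsSmooth.mul v.2 w.2).continuous]
  map_smul' c u := by
    rw [Submodule.coe_smul, mul_smul_comm, mean_smul]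
    rfl

/-- The eigenfunctions of the flat Laplacian with eigenvalue at most `1`. -/
def lowModes : Fin 5 → smoothFunctions :=
  ![⟨cosMode 0, isSmooth_cosMode _⟩, ⟨cosMode ![1, 0], isSmooth_cosMode _⟩,
    ⟨sinMode ![1, 0], isSmooth_sinMode _⟩, ⟨cosMode ![0, 1], isSmooth_cosMode _⟩,
    ⟨sinMode ![0, 1], isSmooth_sinMode _⟩]

lemma cosMode_neg (m : Fin 2 → ℤ) : cosMode (-m) = cosMode m := by
  funext p
  simp only [cosMode, Pi.neg_apply, neg_smul]
  rw [← neg_add, Real.Angle.cos_neg]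

lemma sinMode_neg (m : Fin 2 → ℤ) : sinMode (-m) = -sinMode m := by
  funext p
  simp only [sinMode, Pi.neg_apply, neg_smul]
  rw [← neg_add, Real.Angle.sin_neg]

/-- The lattice points of norm at most one are `0`, `±(1,0)`, `±(0,1)`; opposite points give the
same modes up to sign, and the sine mode at `0` vanishes. So five conditions suffice. -/
lemma mean_mode_eq_zero {u : smoothFunctions} (h : ∀ i, meanMul (lowModes i) u = 0)
    (m : Fin 2 → ℤ) (hm : m 0 ^ 2 + m 1 ^ 2 ≤ 1) :
    mean (cosMode m * u.1) = 0 ∧ mean (sinMode m * u.1) = 0 := by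
  have hneg : ∀ m : Fin 2 → ℤ, mean (cosMode m * u.1) = 0 ∧ mean (sinMode m * u.1) = 0 →
      mean (cosMode (-m) * u.1) = 0 ∧ mean (sinMode (-m) * u.1) = 0 := by
    intro m hm
    rw [cosMode_neg, sinMode_neg, neg_mul, mean_neg, hm.1, hm.2, neg_zero]
    exact ⟨rfl, rfl⟩
  have hx : mean (cosMode ![1, 0] * u.1) = 0 ∧ mean (sinMode ![1, 0] * u.1) = 0 := ⟨h 1, h 2⟩
  have hy : mean (cosMode ![0, 1] * u.1) = 0 ∧ mean (sinMode ![0, 1] * u.1) = 0 := ⟨h 3, h 4⟩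
  have h00 : mean (cosMode 0 * u.1) = 0 ∧ mean (sinMode 0 * u.1) = 0 := by
    refine ⟨h 0, ?_⟩
    simp [mean, lift, sinMode]
  have e : m = ![m 0, m 1] := by
    funext i
    fin_cases i <;> rfl
  have b0 : -1 ≤ m 0 ∧ m 0 ≤ 1 := abs_le.mp (by rw [← sq_le_one_iff_abs_le_one]; nlinarith)
  have b1 : -1 ≤ m 1 ∧ m 1 ≤ 1 := abs_le.mp (by rw [← sq_le_one_iff_abs_le_one]; nlinarith)
  have hcases : m = 0 ∨ m = ![1, 0] ∨ m = -![1, 0] ∨ m = ![0, 1] ∨ m = -![0, 1] := by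
    rw [e]
    obtain ⟨l0, r0⟩ := b0
    obtain ⟨l1, r1⟩ := b1
    generalize m 0 = k at *
    generalize m 1 = l at *
    interval_cases k <;> interval_cases l <;> simp_all
  rcases hcases with rfl | rfl | rfl | rfl | rfl
  exacts [h00, hx, hneg _ hx, hy, hneg _ hy]

namespace Metric

variable {g : Metric} {Q : Real.Angle → ℝ}

/-- A Liouville metric close to the flat one has at most five eigenvalues in `(-∞, 1]`. -/
lemma rank_eigenSpan_Iic_le (hQ : ∀ p, g.coeff p = Q p.1 • (1 : Matrix (Fin 2) (Fin 2) ℝ))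
    (hQ2 : ∀ p : Torus, Q p.1 ≤ 3 / 2) : Module.rank ℝ (g.eigenSpan (Set.Iic 1)) ≤ 5 := by
  let T : g.eigenSpan (Set.Iic 1) →ₗ[ℝ] (Fin 5 → ℝ) :=
    (LinearMap.pi fun i => meanMul (lowModes i)) ∘ₗ
      Submodule.inclusion (eigenSpan_le_smoothFunctions _)
  have hT : Function.Injective T := by
    rw [← LinearMap.ker_eq_bot, LinearMap.ker_eq_bot']
    rintro ⟨w, hw⟩ hTw
    have hs : IsSmooth w := eigenSpan_le_smoothFunctions _ hw
    have hp := two_mul_mean_sq_le hs (mean_mode_eq_zero (u := ⟨w, hs⟩) fun i => congrFun hTw i)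
    have hq := isSmooth_conformalFactor hQ
    have hE : energy w w ≤ mean ((fun p => Q p.1) * (w * w)) := by
      obtain ⟨f, hf, hfs, rfl⟩ := exists_sum_of_mem_eigenSpan hQ hw
      exact energy_sum_le hq (fun p => (conformalFactor_pos hQ p).le) hf fun μ hμ => hfs hμ
    have hle : mean ((fun p => Q p.1) * (w * w)) ≤ mean ((3 / 2 : ℝ) • (w * w)) :=
      mean_mono (hq.mul (hs.mul hs)).continuous ((hs.mul hs).smul _).continuous fun p =>
        mul_le_mul_of_nonneg_right (hQ2 p) (mul_self_nonneg _)
    rw [mean_smul] at hle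
    -- The Poincaré constant `2` exceeds the bound `3/2` on the weight.
    have : mean (w * w) ≤ 0 := by
      unfold energy at hE
      linarith
    exact Subtype.ext (eq_zero_of_mean_mul_self hs.continuous this)
  have := LinearMap.rank_le_of_injective T hT
  simpa using this

/-- A common element is orthogonal to itself for the weighted inner product. -/
lemma disjoint_eigenSpan_Iio (hQ : ∀ p, g.coeff p = Q p.1 • (1 : Matrix (Fin 2) (Fin 2) ℝ))
    (μ : ℝ) : Disjoint (g.eigenSpan (Set.Iio μ)) (weightedEigenspace (fun p => Q p.1) μ) := by
  rw [Submodule.disjoint_def]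
  intro w hw hw'
  have hq := isSmooth_conformalFactor hQ
  obtain ⟨f, hf, hfs, hsum⟩ := exists_sum_of_mem_eigenSpan hQ hw
  have h0 := mean_sum_mul_eq_zero hq hf (fun h => lt_irrefl μ (hfs h)) hw'
  rw [← hsum] at h0
  -- Multiplying by `√Q` turns the weighted norm into the plain one.
  set v : Torus → ℝ := fun p => Real.sqrt (Q p.1) * w p with hv
  have hvv : v * v = (fun p => Q p.1) * (w * w) := by
    funext p
    simp only [hv, Pi.mul_apply]
    rw [mul_mul_mul_comm, Real.mul_self_sqrt (conformalFactor_pos hQ p).le]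
  have hvc : Continuous (lift v) := (Real.continuous_sqrt.comp hq.continuous).mul hw'.1.continuous
  have hv0 := eq_zero_of_mean_mul_self hvc (by rw [hvv, h0])
  funext p
  exact (mul_eq_zero.mp (congrFun hv0 p)).resolve_left
    (Real.sqrt_pos.mpr (conformalFactor_pos hQ p)).ne'

end Metric

namespace Metric

variable {g : Metric} {Q : Real.Angle → ℝ}

/-- The weight does not depend on `y`, so translations in `y` are symmetries of the equation. -/
lemma translate_mem_weightedEigenspace {μ : ℝ} {u : Torus → ℝ} (c : ℝ)
    (hu : u ∈ weightedEigenspace (fun p => Q p.1) μ) :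
    (fun p => u (p + (0, (c : Real.Angle)))) ∈ weightedEigenspace (fun p => Q p.1) μ := by
  refine ⟨?_, ?_⟩
  · have h : lift (fun p => u (p + (0, (c : Real.Angle)))) = fun q => lift u (q + (0, c)) := by
      funext q
      simp [lift]
    unfold IsSmooth
    rw [h]
    exact ContDiff.comp (g := lift u) hu.1 (contDiff_id.add contDiff_const)
  · funext p
    have := congrFun hu.2 (p + (0, (c : Real.Angle)))
    simpa [flatLaplacian, partialDeriv_translate] using this

/-- The translate is `-(1 + a cos(nx)) sin y`; evaluation at `y = 0` and `y = π/2`, for an `x` where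
the first factor is nonzero, separates the two. -/
lemma linearIndependent_trigProduct {n : ℕ} {a : ℝ} (h : trigProduct n a ≠ 0) :
    LinearIndependent ℝ ![trigProduct n a,
      fun p => trigProduct n a (p + (0, ((Real.pi / 2 : ℝ) : Real.Angle)))] := by
  rw [LinearIndependent.pair_iff]
  intro s t hst
  obtain ⟨p, hp⟩ := Function.ne_iff.mp h
  have hf : 1 + a * Real.Angle.cos (n • p.1) ≠ 0 := fun h0 => hp (by simp [trigProduct, h0])
  have h0 := congrFun hst (p.1, 0)
  have h1 := congrFun hst (p.1, ((Real.pi / 2 : ℝ) : Real.Angle))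
  simp [trigProduct, hf, Real.Angle.cos_add] at h0 h1
  exact ⟨h0, h1.resolve_right fun h2 => hf (by linarith)⟩

/-- If the eigenvalue `1` of a Liouville metric close to the flat one has `trigProduct n a` as an
eigenfunction, then its label is at most four. -/
lemma isKthEigenvalue_of_trigProduct
    (hQ : ∀ p, g.coeff p = Q p.1 • (1 : Matrix (Fin 2) (Fin 2) ℝ))
    (hQ2 : ∀ p : Torus, Q p.1 ≤ 3 / 2) {n : ℕ} {a : ℝ}
    (h : g.IsEigenfunction 1 (trigProduct n a)) :
    g.IsKthEigenvalue 2 1 ∨ g.IsKthEigenvalue 3 1 ∨ g.IsKthEigenvalue 4 1 := by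
  have hle := rank_eigenSpan_Iic_le hQ hQ2
  rw [isEigenfunction_iff hQ] at h
  have hli := linearIndependent_trigProduct h.1
  set v := ![trigProduct n a,
      fun p => trigProduct n a (p + (0, ((Real.pi / 2 : ℝ) : Real.Angle)))] with hv
  have hvE : ∀ i, v i ∈ weightedEigenspace (fun p => Q p.1) 1 := by
    rw [Fin.forall_fin_two]
    exact ⟨h.2, translate_mem_weightedEigenspace _ h.2⟩
  have hrank : Module.rank ℝ (Submodule.span ℝ (Set.range v)) = 2 := by
    rw [rank_span hli, Cardinal.mk_range_eq _ hli.injective]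
    simp
  have hspanE : Submodule.span ℝ (Set.range v) ≤ weightedEigenspace (fun p => Q p.1) 1 :=
    Submodule.span_le.mpr (Set.range_subset_iff.mpr hvE)
  have hdisj := (disjoint_eigenSpan_Iio hQ 1).mono_right hspanE
  have hsup : g.eigenSpan (Set.Iio 1) ⊔ Submodule.span ℝ (Set.range v) ≤
      g.eigenSpan (Set.Iic 1) := by
    refine sup_le (Submodule.span_mono ?_) (Submodule.span_le.mpr ?_)
    · rintro u ⟨μ, hμ, hu⟩
      exact ⟨μ, Set.Iio_subset_Iic_self hμ, hu⟩
    · rintro _ ⟨i, rfl⟩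
      exact Submodule.subset_span
        ⟨1, Set.self_mem_Iic, (isEigenfunction_iff hQ).mpr ⟨hli.ne_zero i, hvE i⟩⟩
  have hadd := Submodule.rank_sup_add_rank_inf_eq (g.eigenSpan (Set.Iio 1))
    (Submodule.span ℝ (Set.range v))
  rw [hdisj.eq_bot, rank_bot, add_zero, hrank] at hadd
  have hge : Module.rank ℝ (g.eigenSpan (Set.Iio 1)) + 2 ≤
      Module.rank ℝ (g.eigenSpan (Set.Iic 1)) := hadd ▸ Submodule.rank_mono hsup
  have hone : Module.rank ℝ (g.eigenSpan (Set.Iio 1)) ≠ 0 := by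
    have hc : g.IsEigenfunction 0 (fun _ => 1) := by
      rw [isEigenfunction_iff hQ]
      refine ⟨fun h0 => one_ne_zero (congrFun h0 0), isSmooth_const 1, ?_⟩
      have h0 : (0 : Torus → ℝ) = fun _ => 0 := rfl
      simp only [flatLaplacian, partialDeriv_const]
      rw [h0]
      simp only [partialDeriv_const]
      simp
    rw [Ne, rank_zero_iff, ← not_nontrivial_iff_subsingleton, not_not,
      Submodule.nontrivial_iff_ne_bot]
    exact Submodule.ne_bot_iff _ |>.mpr
      ⟨_, Submodule.subset_span ⟨0, zero_lt_one' ℝ, hc⟩, hc.1⟩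
  -- With `N` eigenvalues below `1` and `M` up to `1`, `1 ≤ N` and `N + 2 ≤ M ≤ 5` force `N ∈ {1, 2,
  -- 3}`; the label is `N + 1`.
  obtain ⟨M, hM⟩ := Cardinal.lt_aleph0.mp (hle.trans_lt (Cardinal.ofNat_lt_aleph0 (n := 5)))
  obtain ⟨N, hN⟩ := Cardinal.lt_aleph0.mp
    (((le_self_add.trans hge).trans hle).trans_lt (Cardinal.ofNat_lt_aleph0 (n := 5)))
  unfold IsKthEigenvalue
  rw [hM] at hle hge
  rw [hN] at hge hone
  rw [hM, hN]
  norm_cast at *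
  omega

end Metric

/-! ### Smallness in `C^k` -/

/-- If `G` is smooth near `0` with `G 0 = 0` and all derivatives of `c` are bounded, then `G (a c)`
tends to `0` in `C^k` as `a → 0`. -/
lemma exists_norm_iteratedFDeriv_comp_lt {E : Type*} [NormedAddCommGroup E] [NormedSpace ℝ E]
    {G : ℝ → ℝ} {t : Set ℝ} (ht : IsOpen t) (h0 : (0 : ℝ) ∈ t) (hG : ContDiffOn ℝ ∞ G t)
    (hG0 : G 0 = 0) {c : E → ℝ} (hc : ContDiff ℝ ∞ c) {k : ℕ} {B : ℝ}
    (hB : ∀ i ≤ k, ∀ x, ‖iteratedFDeriv ℝ i c x‖ ≤ B) {ε : ℝ} (hε : 0 < ε) :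
    ∃ a₀ : ℝ, 0 < a₀ ∧ ∀ a : ℝ, 0 < a → a < a₀ → ∀ m ≤ k, ∀ x,
      ‖iteratedFDeriv ℝ m (fun x => G (a * c x)) x‖ < ε := by
  have hB0 : ∀ x, |c x| ≤ B := fun x => by simpa using hB 0 (Nat.zero_le _) x
  have hBnn : 0 ≤ B := (abs_nonneg _).trans (hB0 0)
  obtain ⟨r, hr, hrt⟩ := Metric.nhds_basis_closedBall.mem_iff.mp (ht.mem_nhds h0)
  have hbound : ∀ i : ℕ, ∃ C, ∀ y ∈ Metric.closedBall (0 : ℝ) r,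
      ‖iteratedFDerivWithin ℝ i G t y‖ ≤ C := fun i =>
    (isCompact_closedBall (0 : ℝ) r).exists_bound_of_continuousOn
      ((hG.continuousOn_iteratedFDerivWithin (mod_cast le_top) ht.uniqueDiffOn).mono hrt)
  choose C hC using hbound
  set K : ℝ := ∑ i ∈ Finset.range (k + 1), |C i| with hK
  have hKnn : 0 ≤ K := Finset.sum_nonneg fun _ _ => abs_nonneg _
  have hCK : ∀ i ≤ k, ∀ y ∈ Metric.closedBall (0 : ℝ) r, ‖iteratedFDerivWithin ℝ i G t y‖ ≤ K :=
    fun i hi y hy => ((hC i y hy).trans (le_abs_self _)).trans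
      (Finset.single_le_sum (f := fun i => |C i|) (fun _ _ => abs_nonneg _)
        (Finset.mem_range.mpr (Nat.lt_succ_of_le hi)))
  obtain ⟨ρ, hρ, hρG⟩ := Metric.continuousAt_iff.mp
    (hG.continuousOn.continuousAt (ht.mem_nhds h0)) ε hε
  set P : ℝ := k.factorial * K with hP
  have hPnn : 0 ≤ P := by positivity
  -- The Faà di Bruno type bound for a composition is `m! K η^m`; this `η` makes it less than `ε`
  -- for `1 ≤ m ≤ k`.
  set η : ℝ := min 1 (ε / (P + 1)) with hη
  have hηpos : 0 < η := lt_min one_pos (by positivity)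
  have hη1 : η ≤ 1 := min_le_left _ _
  have hPη : P * η < ε := by
    have h1 : η * (P + 1) ≤ ε := (le_div_iff₀ (by positivity)).mp (min_le_right _ _)
    nlinarith
  -- `r` keeps `a c` where the derivatives of `G` are bounded, `ρ` makes `G (a c)` itself small, and
  -- `η ^ k` bounds the derivatives of `a c`.
  set σ : ℝ := min (min r ρ) (η ^ k) with hσ
  have hσpos : 0 < σ := lt_min (lt_min hr hρ) (by positivity)
  refine ⟨σ / (B + 1), by positivity, fun a ha haσ m hm x => ?_⟩
  have haB : a * B < σ := by
    have := (lt_div_iff₀ (by positivity)).mp haσ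
    nlinarith
  have hac : ∀ x, |a * c x| < σ := fun x => by
    rw [abs_mul, abs_of_pos ha]
    exact (mul_le_mul_of_nonneg_left (hB0 x) ha.le).trans_lt haB
  have hmem : ∀ x, a * c x ∈ Metric.closedBall (0 : ℝ) r := fun x => by
    rw [mem_closedBall_zero_iff, Real.norm_eq_abs]
    exact (hac x).le.trans ((min_le_left _ _).trans (min_le_left _ _))
  have hcs : ContDiff ℝ ∞ fun x => a * c x := contDiff_const.mul hc
  -- At order zero the composition bound has no factor `η`; continuity and `G 0 = 0` replace it.
  rcases Nat.eq_zero_or_pos m with rfl | hmpos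
  · rw [norm_iteratedFDeriv_zero]
    have := hρG (x := a * c x) (by
      rw [dist_zero_right, Real.norm_eq_abs]
      exact (hac x).trans_le ((min_le_left _ _).trans (min_le_right _ _)))
    rwa [hG0, dist_zero_right] at this
  · have hD : ∀ i, 1 ≤ i → i ≤ m → ‖iteratedFDeriv ℝ i (fun x => a * c x) x‖ ≤ η ^ i := by
      intro i _ hi
      have e : iteratedFDeriv ℝ i (fun x => a * c x) x = a • iteratedFDeriv ℝ i c x :=
        iteratedFDeriv_const_smul_apply (a := a) (hc.of_le (mod_cast le_top)).contDiffAt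
      rw [e, norm_smul, Real.norm_eq_abs, abs_of_pos ha]
      calc a * ‖iteratedFDeriv ℝ i c x‖ ≤ a * B :=
            mul_le_mul_of_nonneg_left (hB i (hi.trans hm) x) ha.le
        _ ≤ η ^ k := haB.le.trans (min_le_right _ _)
        _ ≤ η ^ i := pow_le_pow_of_le_one hηpos.le hη1 (hi.trans hm)
    have key := norm_iteratedFDeriv_comp_le' (N := ∞) (g := G) (f := fun x => a * c x) (n := m)
      (by rintro _ ⟨y, rfl⟩; exact hrt (hmem y)) ht.uniqueDiffOn hG hcs (mod_cast le_top) x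
      (fun i hi => hCK i (hi.trans hm) _ (hmem x)) hD
    refine lt_of_le_of_lt key (lt_of_le_of_lt ?_ hPη)
    have h1 : (m.factorial : ℝ) ≤ k.factorial := by exact_mod_cast Nat.factorial_le hm
    have h2 : η ^ m ≤ η := by
      simpa using pow_le_pow_of_le_one hηpos.le hη1 hmpos
    exact mul_le_mul (mul_le_mul_of_nonneg_right h1 hKnn) h2 (by positivity) hPnn

/-- This is cosine, whose derivatives are bounded by one, after a linear functional of norm at most
`n`. -/
lemma norm_iteratedFDeriv_cos_fst_le (n i : ℕ) (q : ℝ × ℝ) :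
    ‖iteratedFDeriv ℝ i (fun q : ℝ × ℝ => Real.cos (n * q.1)) q‖ ≤ (n : ℝ) ^ i := by
  have e : (fun q : ℝ × ℝ => Real.cos (n * q.1)) =
      Real.cos ∘ ((n : ℝ) • ContinuousLinearMap.fst ℝ ℝ ℝ) := rfl
  have hL : ‖(n : ℝ) • ContinuousLinearMap.fst ℝ ℝ ℝ‖ ≤ n := by
    rw [norm_smul, Real.norm_natCast]
    exact mul_le_of_le_one_right (Nat.cast_nonneg n) (ContinuousLinearMap.norm_fst_le ..)
  rw [e, ContinuousLinearMap.iteratedFDeriv_comp_right _ (Real.contDiff_cos (n := i)) _ le_rfl]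
  refine (ContinuousMultilinearMap.norm_compContinuousLinearMap_le _ _).trans ?_
  rw [norm_iteratedFDeriv_eq_norm_iteratedDeriv, Finset.prod_const, Finset.card_univ,
    Fintype.card_fin]
  calc _ ≤ 1 * (n : ℝ) ^ i :=
        mul_le_mul (Real.abs_iteratedDeriv_cos_le_one _ _)
          (pow_le_pow_left₀ (norm_nonneg _) hL i) (by positivity) zero_le_one
    _ = _ := one_mul _

/-! ### The explicit metric and its eigenfunction -/

/-- The conformal factor for which `trigProduct n a` is an eigenfunction with eigenvalue `1`. -/
def trigFactor (n : ℕ) (a : ℝ) (x : Real.Angle) : ℝ :=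
  1 + n ^ 2 * ((a * Real.Angle.cos (n • x)) / (1 + a * Real.Angle.cos (n • x)))

lemma abs_mul_cos_le {a : ℝ} (ha : 0 < a) (x : Real.Angle) : |a * Real.Angle.cos x| ≤ a := by
  rw [abs_mul, abs_of_pos ha]
  refine mul_le_of_le_one_right ha.le ?_
  induction x using Real.Angle.induction_on with | _ x
  exact Real.abs_cos_le_one x

lemma one_add_mul_cos_pos {a : ℝ} (ha : 0 < a) (ha1 : a < 1) (x : Real.Angle) :
    0 < 1 + a * Real.Angle.cos x := by
  have := (abs_le.mp (abs_mul_cos_le ha x)).1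
  linarith

/-- Over a common denominator the factor is `(1 + (n² + 1) a cos(nx)) / (1 + a cos(nx))`. -/
lemma trigFactor_pos {n : ℕ} {a : ℝ} (ha : 0 < a) (ha' : a * (n ^ 2 + 1) < 1) (x : Real.Angle) :
    0 < trigFactor n a x := by
  have hn : (0 : ℝ) ≤ (n : ℝ) ^ 2 := by positivity
  have ha1 : a < 1 := by nlinarith
  have h1 := one_add_mul_cos_pos ha ha1 (n • x)
  have h2 := (abs_le.mp (abs_mul_cos_le ha (n • x))).1
  unfold trigFactor
  rw [← mul_div_assoc, one_add_div h1.ne']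
  exact div_pos (by nlinarith) h1

lemma lift_trigFactor (n : ℕ) (a : ℝ) :
    lift (fun p => trigFactor n a p.1) = fun q =>
      1 + n ^ 2 * ((a * Real.cos (n * q.1)) / (1 + a * Real.cos (n * q.1))) := by
  funext q
  simp [lift, trigFactor, ← Real.Angle.natCast_mul_eq_nsmul]

lemma contDiff_lift_trigFactor {n : ℕ} {a : ℝ} (ha : 0 < a) (ha1 : a < 1) :
    ContDiff ℝ ω (lift (fun p => trigFactor n a p.1)) := by
  rw [lift_trigFactor]
  have h : ∀ q : ℝ × ℝ, 1 + a * Real.cos (n * q.1) ≠ 0 := fun q =>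
    (one_add_mul_cos_pos ha ha1 ((n * q.1 : ℝ) : Real.Angle)).ne'
  have hc : ContDiff ℝ ω fun q : ℝ × ℝ => a * Real.cos (n * q.1) :=
    contDiff_const.mul (Real.contDiff_cos.comp (contDiff_const.mul contDiff_fst))
  exact contDiff_const.add (contDiff_const.mul (hc.div (contDiff_const.add hc) h))

lemma contDiff_lift_trigFactor_smul_one {n : ℕ} {a : ℝ} (ha : 0 < a) (ha1 : a < 1) (i j : Fin 2) :
    ContDiff ℝ ω (lift fun p => (trigFactor n a p.1 • (1 : Matrix (Fin 2) (Fin 2) ℝ)) i j) :=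
  (contDiff_lift_trigFactor ha ha1).mul (contDiff_const (c := (1 : Matrix (Fin 2) (Fin 2) ℝ) i j))

/-- The Liouville metric for which `trigProduct n a` is an eigenfunction with eigenvalue `1`. -/
def trigMetric (n : ℕ) (a : ℝ) (ha : 0 < a) (ha' : a * (n ^ 2 + 1) < 1) : Metric where
  coeff p := trigFactor n a p.1 • 1
  smooth i j := (contDiff_lift_trigFactor_smul_one ha
    (by nlinarith [sq_nonneg (n : ℝ)]) i j).of_le le_top
  posDef p := Matrix.PosDef.one.smul (trigFactor_pos ha ha' p.1)

lemma flatLaplacian_cosMode (m : Fin 2 → ℤ) :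
    flatLaplacian (cosMode m) = (-((m 0 : ℝ) ^ 2 + (m 1 : ℝ) ^ 2)) • cosMode m := by
  simp only [flatLaplacian, partialDeriv_cosMode, partialDeriv_smul _ (isSmooth_sinMode m),
    partialDeriv_sinMode, smul_smul, ← add_smul]
  congr 1
  ring

/-- Product-to-sum splits the function into flat eigenfunctions with eigenvalues `1` and `n² + 1`.
-/
lemma trigProduct_eq (n : ℕ) (a : ℝ) :
    trigProduct n a =
      cosMode ![0, 1] + (a / 2) • (cosMode ![n, 1] + cosMode ![n, -1]) := by
  funext p
  simp [trigProduct, cosMode, Real.Angle.cos_add]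
  ring

lemma trigProduct_mem_weightedEigenspace {n : ℕ} {a : ℝ} (ha : 0 < a) (ha1 : a < 1) :
    trigProduct n a ∈ weightedEigenspace (fun p => trigFactor n a p.1) 1 := by
  have h1 := isSmooth_cosMode ![0, 1]
  have h2 := isSmooth_cosMode ![(n : ℤ), 1]
  have h3 := isSmooth_cosMode ![(n : ℤ), -1]
  refine ⟨?_, ?_⟩
  · rw [trigProduct_eq]
    exact h1.add ((h2.add h3).smul _)
  · have e : flatLaplacian (trigProduct n a) =
        -cosMode ![0, 1] - ((n : ℝ) ^ 2 + 1) • (trigProduct n a - cosMode ![0, 1]) := by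
      rw [trigProduct_eq, flatLaplacian_add h1 ((h2.add h3).smul _),
        flatLaplacian_smul _ (h2.add h3), flatLaplacian_add h2 h3]
      simp only [flatLaplacian_cosMode]
      funext p
      simp
      ring
    rw [e]
    funext p
    have hp := (one_add_mul_cos_pos ha ha1 (n • p.1)).ne'
    simp [trigProduct, cosMode, trigFactor]
    field_simp
    ring

lemma trigProduct_ne_zero {n : ℕ} {a : ℝ} (ha : 0 < a) (ha1 : a < 1) : trigProduct n a ≠ 0 := by
  intro h
  have h0 := congrFun h (0, 0)
  have := (one_add_mul_cos_pos ha ha1 (n • 0)).ne'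
  simp [trigProduct] at h0 this
  exact this h0

/-! ### Components of the super-level set -/

/-- The point of the unit circle with a given angle. -/
def expI (x : Real.Angle) : ℂ := (Real.Angle.cos x : ℂ) + (Real.Angle.sin x : ℂ) * Complex.I

lemma continuous_expI : Continuous expI :=
  (Complex.continuous_ofReal.comp Real.Angle.continuous_cos).add
    ((Complex.continuous_ofReal.comp Real.Angle.continuous_sin).mul continuous_const)

lemma expI_coe (x : ℝ) : expI (x : Real.Angle) = Complex.exp (x * Complex.I) := by
  simp [expI, Complex.exp_mul_I]

lemma expI_pow (x : Real.Angle) (n : ℕ) : expI x ^ n = expI (n • x) := by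
  induction x using Real.Angle.induction_on with | _ x
  rw [← Real.Angle.natCast_mul_eq_nsmul, expI_coe, expI_coe, ← Complex.exp_nat_mul]
  congr 1
  push_cast
  ring

/-- As `cos y ≤ 1`, the value exceeds `1` only if `1 + a cos(nx)` does. -/
lemma cos_pos_of_one_lt_trigProduct {n : ℕ} {a : ℝ} (ha : 0 < a) (ha1 : a < 1) {p : Torus}
    (hp : 1 < trigProduct n a p) : 0 < Real.Angle.cos (n • p.1) := by
  have h1 := one_add_mul_cos_pos ha ha1 (n • p.1)
  have h2 : Real.Angle.cos p.2 ≤ 1 := by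
    obtain ⟨x, y⟩ := p
    induction y using Real.Angle.induction_on with | _ y
    exact Real.cos_le_one y
  have h3 := mul_le_mul_of_nonneg_left h2 h1.le
  unfold trigProduct at hp
  exact pos_of_mul_pos_right (a := a) (by linarith) ha.le

lemma le_numComponents_trigProduct {n : ℕ} {a : ℝ} (ha : 0 < a) (ha1 : a < 1) :
    (n : ℕ∞) ≤ numComponents {p | 1 < trigProduct n a p} := by
  rcases Nat.eq_zero_or_pos n with rfl | hn
  · simp
  have hn0 : (n : ℂ) ≠ 0 := by exact_mod_cast hn.ne'
  set S : Set Torus := {p | 1 < trigProduct n a p} with hS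
  have hslit : ∀ p : S, expI p.1.1 ^ n ∈ Complex.slitPlane := fun p => by
    rw [expI_pow]
    refine Or.inl ?_
    simpa [expI] using cos_pos_of_one_lt_trigProduct ha ha1 p.2
  have hfin : Finite {z : ℂ // z ^ n = 1} := by
    have : {z : ℂ | z ^ n = 1} ⊆ (Polynomial.nthRootsFinset n (1 : ℂ) : Set ℂ) := fun z hz =>
      (Polynomial.mem_nthRootsFinset hn 1).mpr hz
    exact ((Finset.finite_toSet _).subset this).to_subtype
  -- `e^{ix}` over the principal `n`-th root of `e^{inx}`: continuous, since `e^{inx}` has positive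
  -- real part and avoids the branch cut.
  let φ : S → {z : ℂ // z ^ n = 1} := fun p =>
    ⟨expI p.1.1 * Complex.exp (-(Complex.log (expI p.1.1 ^ n) / n)), by
      rw [mul_pow, ← Complex.exp_nat_mul, mul_neg, mul_div_cancel₀ _ hn0, Complex.exp_neg,
        Complex.exp_log (Complex.slitPlane_ne_zero (hslit p)),
        mul_inv_cancel₀ (Complex.slitPlane_ne_zero (hslit p))]⟩
  have hφ : Continuous φ := by
    refine Continuous.subtype_mk ?_ _
    have hc : Continuous fun p : S => expI p.1.1 :=
      continuous_expI.comp (continuous_fst.comp continuous_subtype_val)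
    exact hc.mul (Complex.continuous_exp.comp
      (((hc.pow n).clog hslit).div_const _).neg)
  have hcosj : ∀ j : Fin n, n • ((2 * Real.pi * j / n : ℝ) : Real.Angle) = 0 := fun j => by
    rw [← Real.Angle.natCast_mul_eq_nsmul, mul_div_cancel₀ _ (by exact_mod_cast hn.ne'),
      mul_comm (2 * Real.pi), Real.Angle.natCast_mul_eq_nsmul, Real.Angle.coe_two_pi, smul_zero]
  let P : Fin n → S := fun j => ⟨(((2 * Real.pi * j / n : ℝ) : Real.Angle), 0), by
    simp [hS, trigProduct, hcosj, ha]⟩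
  have hval : ∀ j, (φ (P j)).1 = Complex.exp (2 * Real.pi * Complex.I / n) ^ (j : ℕ) := fun j => by
    simp only [φ, P]
    rw [expI_pow, hcosj, expI_coe, ← Complex.exp_nat_mul]
    have : expI 0 = 1 := by simp [expI]
    rw [this, Complex.log_one, zero_div, neg_zero, Complex.exp_zero, mul_one]
    congr 1
    push_cast
    ring
  -- The finite target is totally disconnected, so `φ` factors through components; the maxima `x =
  -- 2πj/n`, `y = 0` go to distinct roots of unity.
  have hinj : Function.Injective fun j => (P j : ConnectedComponents S) := by
    intro i j hij
    have h := congrArg hφ.connectedComponentsLift hij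
    simp only [Continuous.connectedComponentsLift_apply_coe] at h
    have h' := congrArg Subtype.val h
    rw [hval, hval] at h'
    exact Fin.ext ((Complex.isPrimitiveRoot_exp n hn.ne').pow_inj i.2 j.2 h')
  have := ENat.card_le_card_of_injective hinj
  simpa [numComponents] using this

end Torus

theorem proposition4p4 (n : ℕ) :
    (∀ (k : ℕ) (ε : ℝ), 0 < ε → ∃ a₀ : ℝ, 0 < a₀ ∧ ∀ a : ℝ, 0 < a → a < a₀ →
      ∃ g : Torus.Metric, g.IsRealAnalytic ∧ g.IsLiouville ∧
        Torus.Metric.IsCkClose k ε g Torus.Metric.flat ∧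
        g.IsEigenfunction 1 (Torus.trigProduct n a) ∧
        (n : ℕ∞) ≤ Torus.numComponents {p | 1 < Torus.trigProduct n a p}) ∧
    (4 ≤ n → ∃ δ : ℝ, 0 < δ ∧ ∀ (a : ℝ) (g : Torus.Metric), g.IsRealAnalytic → g.IsLiouville →
      Torus.Metric.IsCkClose 0 δ g Torus.Metric.flat →
      g.IsEigenfunction 1 (Torus.trigProduct n a) →
      g.IsKthEigenvalue 2 1 ∨ g.IsKthEigenvalue 3 1 ∨ g.IsKthEigenvalue 4 1) := by
  -- `δ = 1/2` yields `Q ≤ 3/2`, safely below the flat eigenvalue `2`.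
  refine ⟨fun k ε hε => ?_, fun _ => ⟨1 / 2, by norm_num, fun a g _ hL hclose h => ?_⟩⟩
  · have hG : ContDiffOn ℝ ∞ (fun s : ℝ => s / (1 + s)) (Set.Ioi (-1)) :=
      contDiffOn_id.div (contDiffOn_const.add contDiffOn_id) fun s hs => by
        have : -1 < s := hs
        exact ne_of_gt (by simpa using (by linarith : 0 < 1 + s))
    have hc : ContDiff ℝ ∞ fun q : ℝ × ℝ => Real.cos (n * q.1) :=
      Real.contDiff_cos.comp (contDiff_const.mul contDiff_fst)
    have hB : ∀ i ≤ k, ∀ q, ‖iteratedFDeriv ℝ i (fun q : ℝ × ℝ => Real.cos (n * q.1)) q‖ ≤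
        ((n : ℝ) + 1) ^ k := fun i hi q =>
      (Torus.norm_iteratedFDeriv_cos_fst_le n i q).trans
        ((pow_le_pow_left₀ (Nat.cast_nonneg n) (by linarith) i).trans
          (pow_le_pow_right₀ (by linarith [(Nat.cast_nonneg n : (0 : ℝ) ≤ n)]) hi))
    -- The nonzero coefficients of `g - g₀` are `n² G(a cos(nx))` with `G(s) = s/(1+s)`; dividing
    -- `ε` by `n² + 1` absorbs the factor `n²`.
    obtain ⟨a₁, ha₁, H⟩ := Torus.exists_norm_iteratedFDeriv_comp_lt isOpen_Ioi
      (show (0 : ℝ) ∈ Set.Ioi (-1) by simp) hG (by simp) hc hB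
      (show 0 < ε / ((n : ℝ) ^ 2 + 1) by positivity)
    -- The second bound ensures that the conformal factor is positive.
    refine ⟨min a₁ (1 / ((n : ℝ) ^ 2 + 1)), lt_min ha₁ (by positivity), fun a ha ha' => ?_⟩
    have han : a * ((n : ℝ) ^ 2 + 1) < 1 :=
      (lt_div_iff₀ (by positivity)).mp (ha'.trans_le (min_le_right _ _))
    have ha1 : a < 1 := by nlinarith [sq_nonneg (n : ℝ)]
    have hQ : ∀ p, (Torus.trigMetric n a ha han).coeff p =
        Torus.trigFactor n a p.1 • (1 : Matrix (Fin 2) (Fin 2) ℝ) := fun _ => rfl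
    refine ⟨Torus.trigMetric n a ha han, fun i j => ?_, ⟨_, hQ⟩, fun m hm i j p => ?_, ?_,
      Torus.le_numComponents_trigProduct ha ha1⟩
    · exact (Torus.contDiff_lift_trigFactor_smul_one ha ha1 i j).analyticOnNhd
    · have e : Torus.lift (fun q => (Torus.trigMetric n a ha han).coeff q i j -
          Torus.Metric.flat.coeff q i j) =
          ((n : ℝ) ^ 2 * (1 : Matrix (Fin 2) (Fin 2) ℝ) i j) • fun q : ℝ × ℝ =>
            (fun s : ℝ => s / (1 + s)) (a * Real.cos (n * q.1)) := by
        have e0 := Torus.lift_trigFactor n a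
        funext q
        have e1 := congrFun e0 q
        simp only [Torus.lift] at e1
        simp only [Torus.lift, hQ, Torus.Metric.flat, Matrix.smul_apply, smul_eq_mul, e1,
          Pi.smul_apply]
        ring
      have hcd : ContDiff ℝ m fun q : ℝ × ℝ =>
          (fun s : ℝ => s / (1 + s)) (a * Real.cos (n * q.1)) :=
        (hG.comp_contDiff (contDiff_const.mul hc) fun q => by
          have := Torus.one_add_mul_cos_pos ha ha1 ((n * q.1 : ℝ) : Real.Angle)
          rw [Real.Angle.cos_coe] at this
          rw [Set.mem_Ioi]
          linarith).of_le (mod_cast le_top)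
      rw [e, iteratedFDeriv_const_smul_apply hcd.contDiffAt, norm_smul, norm_mul]
      have h1 : ‖(1 : Matrix (Fin 2) (Fin 2) ℝ) i j‖ ≤ 1 := by
        rw [Matrix.one_apply]
        split_ifs <;> simp
      have h2 := (lt_div_iff₀ (by positivity)).mp
        (H a ha (ha'.trans_le (min_le_left _ _)) m hm p)
      refine lt_of_le_of_lt ?_ h2
      rw [mul_comm]
      refine mul_le_mul_of_nonneg_left ?_ (norm_nonneg _)
      rw [Real.norm_of_nonneg (by positivity)]
      nlinarith [sq_nonneg (n : ℝ), norm_nonneg ((1 : Matrix (Fin 2) (Fin 2) ℝ) i j)]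
    · rw [Torus.Metric.isEigenfunction_iff hQ]
      exact ⟨Torus.trigProduct_ne_zero ha ha1, Torus.trigProduct_mem_weightedEigenspace ha ha1⟩
  · obtain ⟨Q, hQ⟩ := hL
    refine Torus.Metric.isKthEigenvalue_of_trigProduct hQ (fun p => ?_) h
    obtain ⟨q, rfl⟩ := Torus.exists_coe p
    have := hclose 0 le_rfl 0 0 q
    rw [norm_iteratedFDeriv_zero] at this
    have h2 := (abs_lt.mp this).2
    simp [Torus.lift, hQ, Torus.Metric.flat] at h2
    change Q _ ≤ _
    linarith

end
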